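/- **Setting.** A *Clifford+T circuit of depth $d$ on an $a\times b$ grid* acts on one qubit per grid site and consists of $d$ layers. Each layer consists of gates acting on pairwise disjoint sets of qubits, and each gate is a T gate $\mathrm{diag}(1,e^{i\pi/4})$ on one qubit, a one-qubit Clifford gate, or a two-qubit Clifford gate on two nearest-neighbour sites. (A Clifford gate is a unitary that conjugates every tensor product of Pauli matrices to a tensor product of Pauli matrices, up to a phase.) Given such a circuit $Q$, with $n$ of its qubits designated as input qubits and $m$ designated as output qubits, let $|x\rangle$, for $x\in\{0,1\}^n$, be the computational basis state in which the input qubits hold $x$ and any other qubits hold $0$. The circuit *defines* the relation $R:\{0,1\}^n\times\{0,1\}^m\to\{0,1\}$ given by $$R(x,y)=1\iff \langle y|Q|x\rangle\neq 0,$$ where $\langle y|$ is applied to the output qubits (so $\langle y|Q|x\rangle$ is a vector on the unmeasured qubits, and the condition says that $y$ is a measurement outcome of nonzero probability). A *randomized classical circuit of fan-in two* is an acyclic network of AND, OR and NOT gates with unrestricted fan-out, which reads the bits of $x$, constants, and any number of independent uniformly random bits. Its depth is the largest number of gates on a path. **Theorem.** There is a function $\gamma:(0,\infty)\to\mathbb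 R$ such that for all $d,A\in\mathbb N$ there is a constant $K$, depending only on $d$ and $A$, with the following property. Let $c>0$, $n\ge 2$, $m\ge 0$, and let $R:\{0,1\}^n\times\{0,1\}^m\to\{0,1\}$ be a relation defined by a Clifford+T circuit of depth at most $d$ on a two-dimensional rectangular grid with at most $A n$ qubits. (For $A=1$ the grid consists of exactly the $n$ input qubits.) Then there is a randomized classical circuit $C$ of fan-in two and depth at most $c\log n$ such that for every input $x\in\{0,1\}^n$ $$\Pr\bigl[R(x,C(x))=1\bigr]\;\ge\;\exp\Bigl(-\gamma(c)\,K\,\frac{n}{\sqrt{\log n}}\Bigr),$$ where the probability is over the random bits of $C$. -/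

import Mathlib

noncomputable section

namespace ShallowGrid

/-! ### Clifford and T gates -/

/-- The four single-qubit Pauli labels. -/
inductive Pauli
  | I | X | Y | Z

/-- The single-qubit Pauli matrices; `false` is the basis state `|0⟩`, `true` is `|1⟩`. -/
def Pauli.mat : Pauli → Matrix Bool Bool ℂ
  | .I => fun s t => if s = t then 1 else 0
  | .X => fun s t => if s = t then 0 else 1
  | .Y => fun s t => if s = t then 0 else if s then Complex.I else -Complex.I
  | .Z => fun s t => if s = t then (if s then -1 else 1) else 0

/-- The `k`-qubit Pauli string `p 0 ⊗ ⋯ ⊗ p (k-1)`. -/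
def pauliString {k : ℕ} (p : Fin k → Pauli) : Matrix (Fin k → Bool) (Fin k → Bool) ℂ :=
  fun s t => ∏ i, (p i).mat (s i) (t i)

/-- A `k`-qubit Clifford operator: a unitary that conjugates Pauli strings to Pauli strings,
up to a phase `1, i, -1, -i`. -/
def IsClifford {k : ℕ} (U : Matrix (Fin k → Bool) (Fin k → Bool) ℂ) : Prop :=
  U ∈ Matrix.unitaryGroup (Fin k → Bool) ℂ ∧
    ∀ p : Fin k → Pauli, ∃ (q : Fin k → Pauli) (e : ℕ),
      U * pauliString p * U.conjTranspose = Complex.I ^ e • pauliString q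

/-- The T gate `diag(1, exp(iπ/4))`. -/
def tMatrix : Matrix (Fin 1 → Bool) (Fin 1 → Bool) ℂ :=
  Matrix.diagonal fun s => if s 0 then Complex.exp (Complex.I * (Real.pi / 4)) else 1

/-! ### Quantum circuits on a two-dimensional grid -/

/-- The qubits of an `a × b` grid. -/
abbrev Site (a b : ℕ) : Type := Fin a × Fin b

/-- Nearest-neighbour adjacency on the `a × b` grid. -/
abbrev gridGraph (a b : ℕ) : SimpleGraph (Site a b) :=
  (SimpleGraph.pathGraph a).boxProd (SimpleGraph.pathGraph b)

/-- Vectors of `(ℂ²)^{⊗V}`, by their amplitudes in the computational basis. -/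
abbrev QState (V : Type) : Type := (V → Bool) → ℂ

/-- Apply the `k`-qubit operator `U` to the distinct qubits `w 0, …, w (k-1)`
(and the identity to all other qubits). -/
def applyAt {V : Type} {k : ℕ} (w : Fin k → V) (U : Matrix (Fin k → Bool) (Fin k → Bool) ℂ)
    (ψ : QState V) : QState V :=
  fun s => ∑ t : Fin k → Bool, U (fun i => s (w i)) t * ψ (Function.extend w t s)

/-- The gates: a T gate or a one-qubit Clifford gate on a site,
or a two-qubit Clifford gate on two neighbouring sites. -/
inductive GridGate (a b : ℕ) : Type
  | T (v : Site a b)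
  | clifford₁ (v : Site a b) (U : Matrix (Fin 1 → Bool) (Fin 1 → Bool) ℂ) (hU : IsClifford U)
  | clifford₂ (u v : Site a b) (huv : (gridGraph a b).Adj u v)
      (U : Matrix (Fin 2 → Bool) (Fin 2 → Bool) ℂ) (hU : IsClifford U)

/-- The set of qubits on which a gate acts. -/
def GridGate.support {a b : ℕ} : GridGate a b → Finset (Site a b)
  | .T v => {v}
  | .clifford₁ v _ _ => {v}
  | .clifford₂ u v _ _ _ => {u, v}

/-- The action of a gate on states. -/
def GridGate.apply {a b : ℕ} : GridGate a b → QState (Site a b) → QState (Site a b)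
  | .T v => applyAt ![v] tMatrix
  | .clifford₁ v U _ => applyAt ![v] U
  | .clifford₂ u v _ U _ => applyAt ![u, v] U

/-- A layer: gates acting on pairwise disjoint sets of qubits. -/
structure GridLayer (a b : ℕ) : Type where
  gates : List (GridGate a b)
  disjoint : gates.Pairwise fun g h => Disjoint g.support h.support

/-- The action of a layer on states (its gates commute, so their order is irrelevant). -/
def GridLayer.apply {a b : ℕ} (L : GridLayer a b) (ψ : QState (Site a b)) :
    QState (Site a b) :=
  L.gates.foldl (fun φ g => g.apply φ) ψ

/-- A Clifford+T circuit on the `a × b` grid, as the list of its layers, first layer first. -/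
structure GridCircuit (a b : ℕ) : Type where
  layers : List (GridLayer a b)

/-- The depth is the number of layers. -/
def GridCircuit.depth {a b : ℕ} (Q : GridCircuit a b) : ℕ := Q.layers.length

/-- The action of a circuit on states. -/
def GridCircuit.apply {a b : ℕ} (Q : GridCircuit a b) (ψ : QState (Site a b)) :
    QState (Site a b) :=
  Q.layers.foldl (fun φ L => L.apply φ) ψ

/-- The computational basis state in which the input qubits hold `x` and all others hold `0`. -/
def inputKet {V : Type} [Fintype V] {n : ℕ} (inp : Fin n ↪ V) (x : Fin n → Bool) : QState V :=
  fun s => open Classical in if s = Function.extend inp x (fun _ => false) then 1 else 0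

/-- `⟨y|Q|x⟩ ≠ 0`, where `⟨y|` acts on the measured qubits `out` only. So `⟨y|Q|x⟩` is a vector on
the unmeasured qubits, and it is nonzero iff one of its amplitudes is, that is, iff `y` is an
outcome of nonzero probability. -/
def GridCircuit.Outputs {a b n m : ℕ} (Q : GridCircuit a b) (inp : Fin n ↪ Site a b)
    (out : Fin m ↪ Site a b) (x : Fin n → Bool) (y : Fin m → Bool) : Prop :=
  ∃ s : Site a b → Bool, (∀ j, s (out j) = y j) ∧ Q.apply (inputKet inp x) s ≠ 0

/-- The relation `R` is defined by a Clifford+T circuit of depth at most `d` on a grid of at most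
`N` qubits: `R x y = 1` iff `⟨y|Q|x⟩ ≠ 0`. -/
def DefinedOnGrid (d N : ℕ) {n m : ℕ} (R : (Fin n → Bool) → (Fin m → Bool) → Bool) : Prop :=
  ∃ (a b : ℕ) (Q : GridCircuit a b) (inp : Fin n ↪ Site a b) (out : Fin m ↪ Site a b),
    a * b ≤ N ∧ Q.depth ≤ d ∧ ∀ x y, R x y = true ↔ Q.Outputs inp out x y

/-! ### Randomized classical circuits of fan-in two -/

/-- A Boolean gate reading from `w` wires. -/
inductive BoolGate (w : ℕ) : Type
  | const (v : Bool)
  | not (i : Fin w)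
  | and (i j : Fin w)
  | or (i j : Fin w)

/-- The value of a gate, given the values of the wires. -/
def BoolGate.eval {w : ℕ} (val : Fin w → Bool) : BoolGate w → Bool
  | .const v => v
  | .not i => !(val i)
  | .and i j => val i && val j
  | .or i j => val i || val j

/-- The depth of a gate, given the depths of the wires. Constants have depth `0`. -/
def BoolGate.depth {w : ℕ} (dep : Fin w → ℕ) : BoolGate w → ℕ
  | .const _ => 0
  | .not i => dep i + 1
  | .and i j => max (dep i) (dep j) + 1
  | .or i j => max (dep i) (dep j) + 1

/-- An acyclic network with `k` input wires and `w` wires in total. The gates are listed in a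
topological order, each one reading wires that are already there. Fan-out is unrestricted. -/
inductive Network (k : ℕ) : ℕ → Type
  | inputs : Network k k
  | snoc {w : ℕ} (P : Network k w) (g : BoolGate w) : Network k (w + 1)

/-- The values of all wires on a given input. -/
def Network.eval {k : ℕ} (z : Fin k → Bool) : {w : ℕ} → Network k w → Fin w → Bool
  | _, .inputs => z
  | _, .snoc P g => Fin.snoc (α := fun _ => Bool) (P.eval z) (g.eval (P.eval z))

/-- The depths of all wires: the largest number of gates on a path from a source. -/
def Network.wireDepth {k : ℕ} : {w : ℕ} → Network k w → Fin w → ℕ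
  | _, .inputs => fun _ => 0
  | _, .snoc P g => Fin.snoc (α := fun _ => ℕ) P.wireDepth (g.depth P.wireDepth)

/-- A randomized classical circuit with `n` input bits and `m` output bits, which also reads
`coins` independent uniformly random bits. -/
structure RandCircuit (n m : ℕ) : Type where
  coins : ℕ
  wires : ℕ
  net : Network (n + coins) wires
  out : Fin m → Fin wires

/-- The output of the circuit on input `x` and random bits `r`. -/
def RandCircuit.run {n m : ℕ} (C : RandCircuit n m) (x : Fin n → Bool)
    (r : Fin C.coins → Bool) : Fin m → Bool :=
  fun j => C.net.eval (Fin.append x r) (C.out j)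

/-- The depth of the circuit: the maximal depth of a wire. -/
def RandCircuit.depth {n m : ℕ} (C : RandCircuit n m) : ℕ :=
  Finset.univ.sup C.net.wireDepth

/-- `Pr[R(x, C(x)) = 1]`, over the random bits of `C`. -/
def RandCircuit.successProb {n m : ℕ} (C : RandCircuit n m)
    (R : (Fin n → Bool) → (Fin m → Bool) → Bool) (x : Fin n → Bool) : ℝ :=
  ((Finset.univ.filter fun r : Fin C.coins → Bool => R x (C.run x r) = true).card : ℝ)
    / 2 ^ C.coins

end ShallowGrid

end

/-! Cut the grid into `ℓ × ℓ` blocks. A slice of the final state `Q|x⟩` along a block (all bits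
outside it fixed) lies in a subspace that depends only on the input bits inside the block. This
subspace starts with dimension at most one. Gates inside the block map it to an image, and gates
outside only form linear combinations of slices. A gate across the boundary acts on the block
through the four operators `|p⟩⟨q|` on one boundary qubit, so it multiplies the dimension by at most
4. After `d` layers the dimension is at most `4 ^ (d * s)`, where `s` is the number of boundary
qubits of the block (`GridCircuit.slice_apply_mem`, `GridCircuit.finrank_blockStep_le`).

A space of functions of dimension `r` is separated by `r` points (`exists_separating`), so `2 * d *
s` bits suffice to name a separating string for the block. Products of separating sets separate
states whose slices lie in these spaces (`exists_ne_zero_of_slices`). As `Q|x⟩ ≠ 0`, some choice of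
one string per block has nonzero amplitude. The classical circuit guesses this choice with its
coins. Each output bit depends on `O(d ℓ²)` bits, hence has depth `O(d ℓ²)`, and the total number of
coins is `O(d N / ℓ)` for `N` qubits. Taking `ℓ` of order `√(c log n / d)` gives the bound (for `d =
0`, read `d` as 1 under the root). -/

noncomputable section

namespace ShallowGrid

/-! ### Gate actions as linear maps -/

section LinearAction

variable {V : Type} {k : ℕ}

/-- `applyAt` as a linear map. -/
def applyAtLin (w : Fin k → V) (U : Matrix (Fin k → Bool) (Fin k → Bool) ℂ) :
    QState V →ₗ[ℂ] QState V where
  toFun := applyAt w U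
  map_add' φ ψ := by
    funext s
    simp [applyAt, mul_add, Finset.sum_add_distrib]
  map_smul' c ψ := by
    funext s
    simp only [applyAt, Pi.smul_apply, smul_eq_mul, RingHom.id_apply, Finset.mul_sum]
    exact Finset.sum_congr rfl fun t _ => by ring

theorem extend_comp_self {w : Fin k → V} (hw : Function.Injective w) (t : Fin k → Bool)
    (s : V → Bool) : (fun i => Function.extend w t s (w i)) = t :=
  funext fun i => hw.extend_apply t s i

theorem extend_extend {w : Fin k → V} (hw : Function.Injective w) (t t' : Fin k → Bool)
    (s : V → Bool) :
    Function.extend w t (Function.extend w t' s) = Function.extend w t s := by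
  funext v
  by_cases hv : ∃ j, w j = v
  · obtain ⟨j, rfl⟩ := hv
    simp [hw.extend_apply]
  · simp [Function.extend_apply' _ _ _ hv]

theorem extend_restrict_self {w : Fin k → V} (hw : Function.Injective w) (s : V → Bool) :
    Function.extend w (fun i => s (w i)) s = s := by
  funext v
  by_cases hv : ∃ j, w j = v
  · obtain ⟨j, rfl⟩ := hv
    simp [hw.extend_apply]
  · simp [Function.extend_apply' _ _ _ hv]

theorem applyAt_applyAt {w : Fin k → V} (hw : Function.Injective w)
    (A B : Matrix (Fin k → Bool) (Fin k → Bool) ℂ) (ψ : QState V) :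
    applyAt w A (applyAt w B ψ) = applyAt w (A * B) ψ := by
  funext s
  simp only [applyAt, extend_comp_self hw, extend_extend hw, Matrix.mul_apply, Finset.mul_sum,
    Finset.sum_mul]
  rw [Finset.sum_comm]
  exact Finset.sum_congr rfl fun t _ => Finset.sum_congr rfl fun t' _ => by ring

theorem applyAt_one {w : Fin k → V} (hw : Function.Injective w) (ψ : QState V) :
    applyAt w 1 ψ = ψ := by
  funext s
  simp [applyAt, Matrix.one_apply, extend_restrict_self hw]

/-- Undo the gate with `star U`. This is what guarantees that every input has at least one possible
outcome. -/
theorem applyAt_ne_zero {w : Fin k → V} (hw : Function.Injective w)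
    {U : Matrix (Fin k → Bool) (Fin k → Bool) ℂ} (hU : U ∈ Matrix.unitaryGroup (Fin k → Bool) ℂ)
    {ψ : QState V} (hψ : ψ ≠ 0) : applyAt w U ψ ≠ 0 := by
  intro h
  apply hψ
  rw [← applyAt_one hw ψ, ← Matrix.mem_unitaryGroup_iff'.1 hU, ← applyAt_applyAt hw, h]
  exact (applyAtLin w (star U)).map_zero

end LinearAction

/-! ### Circuits preserve nonzero states -/

theorem tMatrix_mem_unitaryGroup : tMatrix ∈ Matrix.unitaryGroup (Fin 1 → Bool) ℂ := by
  rw [Matrix.mem_unitaryGroup_iff', tMatrix, Matrix.star_eq_conjTranspose,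
    Matrix.diagonal_conjTranspose, Matrix.diagonal_mul_diagonal, ← Matrix.diagonal_one]
  congr 1
  funext s
  by_cases h : s 0
  · simp only [Pi.star_apply, h, if_true, RCLike.star_def, ← Complex.exp_conj, ← Complex.exp_add]
    simp [map_ofNat]
  · simp [h]

theorem injective_pair {V : Type} {u v : V} (h : u ≠ v) : Function.Injective ![u, v] := by
  intro i j hij
  fin_cases i <;> fin_cases j <;> simp_all [eq_comm]

theorem GridGate.apply_ne_zero {a b : ℕ} (g : GridGate a b) {ψ : QState (Site a b)} (hψ : ψ ≠ 0) :
    g.apply ψ ≠ 0 := by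
  cases g with
  | T v =>
    exact applyAt_ne_zero (Function.injective_of_subsingleton _) tMatrix_mem_unitaryGroup hψ
  | clifford₁ v U hU => exact applyAt_ne_zero (Function.injective_of_subsingleton _) hU.1 hψ
  | clifford₂ u v huv U hU => exact applyAt_ne_zero (injective_pair huv.ne) hU.1 hψ

theorem GridLayer.apply_ne_zero {a b : ℕ} (L : GridLayer a b) {ψ : QState (Site a b)}
    (hψ : ψ ≠ 0) : L.apply ψ ≠ 0 :=
  List.foldlRecOn (motive := fun φ => φ ≠ 0) L.gates _ hψ fun _ h g _ => g.apply_ne_zero h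

theorem GridCircuit.apply_ne_zero {a b : ℕ} (Q : GridCircuit a b) {ψ : QState (Site a b)}
    (hψ : ψ ≠ 0) : Q.apply ψ ≠ 0 :=
  List.foldlRecOn (motive := fun φ => φ ≠ 0) Q.layers _ hψ fun _ h L _ => L.apply_ne_zero h

theorem inputKet_ne_zero {V : Type} [Fintype V] {n : ℕ} (inp : Fin n ↪ V) (x : Fin n → Bool) :
    inputKet inp x ≠ 0 := fun h => by
  have := congrFun h (Function.extend inp x fun _ => false)
  simp [inputKet] at this

/-! ### Slices of a state along a block of qubits -/

section Slices

variable {V I : Type} [DecidableEq I] (β : V → I)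

/-- The bit string that is `y` on block `i` and `s` elsewhere. -/
def mix (i : I) (y s : V → Bool) : V → Bool := fun v => if β v = i then y v else s v

/-- The vector on block `i` obtained from `ψ` by fixing all other bits to `s`. -/
def slice (ψ : QState V) (i : I) (s : V → Bool) : QState V := fun y => ψ (mix β i y s)

variable {β} {k : ℕ} {w : Fin k → V} {i : I}

theorem slice_applyAt_of_forall_eq (hw : Function.Injective w) (h : ∀ j, β (w j) = i)
    (U : Matrix (Fin k → Bool) (Fin k → Bool) ℂ) (ψ : QState V) (s : V → Bool) :
    slice β (applyAt w U ψ) i s = applyAt w U (slice β ψ i s) := by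
  funext y
  have h₁ : (fun j => mix β i y s (w j)) = fun j => y (w j) := by
    funext j; simp [mix, h]
  have h₂ : ∀ t, Function.extend w t (mix β i y s) = mix β i (Function.extend w t y) s := by
    intro t
    funext v
    by_cases hv : ∃ j, w j = v
    · obtain ⟨j, rfl⟩ := hv
      simp [mix, h, hw.extend_apply]
    · simp [mix, Function.extend_apply' _ _ _ hv]
  simp only [slice, applyAt, h₁, h₂]

/-- A gate outside the block only recombines slices belonging to different outer strings, so any
subspace containing all slices still contains them afterwards. -/
theorem slice_applyAt_of_forall_ne (hw : Function.Injective w) (h : ∀ j, β (w j) ≠ i)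
    (U : Matrix (Fin k → Bool) (Fin k → Bool) ℂ) (ψ : QState V) (s : V → Bool) :
    slice β (applyAt w U ψ) i s =
      ∑ t, U (fun j => s (w j)) t • slice β ψ i (Function.extend w t s) := by
  funext y
  have h₁ : (fun j => mix β i y s (w j)) = fun j => s (w j) := by
    funext j; simp [mix, h]
  have h₂ : ∀ t, Function.extend w t (mix β i y s) = mix β i y (Function.extend w t s) := by
    intro t
    funext v
    by_cases hv : ∃ j, w j = v
    · obtain ⟨j, rfl⟩ := hv
      simp [mix, h, hw.extend_apply]
    · simp [mix, Function.extend_apply' _ _ _ hv]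
  simp only [slice, applyAt, h₁, h₂, Finset.sum_apply, Pi.smul_apply, smul_eq_mul]

open Classical in
/-- The operator `|p⟩⟨q|` on the qubit `v`. -/
def siteUnit (v : V) (p q : Bool) : QState V →ₗ[ℂ] QState V where
  toFun φ y := if y v = p then φ (Function.update y v q) else 0
  map_add' φ ψ := by
    funext y
    by_cases h : y v = p <;> simp [h]
  map_smul' c ψ := by
    funext y
    by_cases h : y v = p <;> simp [h]

/-- Expand `U` in matrix units: on the only qubit of the gate that lies in the block, each term acts
as some `|p⟩⟨q|`. The coefficients depend on the outer bits, but the four operators do not. -/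
theorem slice_applyAt_of_single (hw : Function.Injective w) (j₀ : Fin k) (h₀ : β (w j₀) = i)
    (h : ∀ j, j ≠ j₀ → β (w j) ≠ i)
    (U : Matrix (Fin k → Bool) (Fin k → Bool) ℂ) (ψ : QState V) (s : V → Bool) :
    slice β (applyAt w U ψ) i s =
      ∑ t, ∑ p, U (Function.update (fun j => s (w j)) j₀ p) t •
        siteUnit (w j₀) p (t j₀) (slice β ψ i (Function.extend w t s)) := by
  classical
  funext y
  have h₁ : (fun j => mix β i y s (w j)) = Function.update (fun j => s (w j)) j₀ (y (w j₀)) := by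
    funext j
    by_cases hj : j = j₀
    · subst hj; simp [mix, h₀]
    · simp [mix, h j hj, hj]
  have h₂ : ∀ t, Function.extend w t (mix β i y s) =
      mix β i (Function.update y (w j₀) (t j₀)) (Function.extend w t s) := by
    intro t
    funext v
    by_cases hv : ∃ j, w j = v
    · obtain ⟨j, rfl⟩ := hv
      by_cases hj : j = j₀
      · subst hj; simp [mix, h₀, hw.extend_apply]
      · simp [mix, h j hj, hw.extend_apply]
    · have : v ≠ w j₀ := fun hv' => hv ⟨j₀, hv'.symm⟩
      simp [mix, Function.extend_apply' _ _ _ hv, this]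
  simp only [slice, applyAt, h₁, h₂, Finset.sum_apply, Pi.smul_apply, smul_eq_mul, siteUnit,
    LinearMap.coe_mk, AddHom.coe_mk, mul_ite, mul_zero]
  refine Finset.sum_congr rfl fun t _ => ?_
  rw [Finset.sum_ite_eq]
  simp

/-- Replace `W` by the sum of its images under the four operators `|p⟩⟨q|` on the qubit `v`. -/
def siteSpread (v : V) (W : Submodule ℂ (QState V)) : Submodule ℂ (QState V) :=
  ⨆ p : Bool × Bool, W.map (siteUnit v p.1 p.2)

theorem finrank_siteSpread_le [Finite V] (v : V) (W : Submodule ℂ (QState V)) :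
    Module.finrank ℂ (siteSpread v W) ≤ 4 * Module.finrank ℂ W := by
  have key : ∀ S : Finset (Bool × Bool),
      Module.finrank ℂ (S.sup fun p => W.map (siteUnit v p.1 p.2) : Submodule ℂ (QState V)) ≤
        S.card * Module.finrank ℂ W := by
    classical
    intro S
    induction S using Finset.induction_on with
    | empty => simp
    | insert p S hp ih =>
      rw [Finset.sup_insert, Finset.card_insert_of_notMem hp, add_mul, one_mul, add_comm]
      exact (Submodule.finrank_add_le_finrank_add_finrank _ _).trans
        (add_le_add (Submodule.finrank_map_le _ _) ih)
  have := key Finset.univ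
  rwa [Finset.sup_univ_eq_iSup] at this

theorem slice_applyAt_mem_siteSpread (hw : Function.Injective w) (j₀ : Fin k) (h₀ : β (w j₀) = i)
    (h : ∀ j, j ≠ j₀ → β (w j) ≠ i) (U : Matrix (Fin k → Bool) (Fin k → Bool) ℂ) {ψ : QState V}
    {W : Submodule ℂ (QState V)} (hψ : ∀ s, slice β ψ i s ∈ W) (s : V → Bool) :
    slice β (applyAt w U ψ) i s ∈ siteSpread (w j₀) W := by
  rw [slice_applyAt_of_single hw j₀ h₀ h]
  refine Submodule.sum_mem _ fun t _ => Submodule.sum_mem _ fun p _ => Submodule.smul_mem _ _ ?_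
  exact Submodule.mem_iSup_of_mem (p, t j₀) (Submodule.mem_map_of_mem (hψ _))

end Slices

/-! ### The space of block states generated by a circuit -/

section BlockSpace

variable {a b : ℕ} {I : Type} [DecidableEq I] (β : Site a b → I)

/-- A subspace containing all slices along block `i` after a gate, if `W` contains them before. -/
def GridGate.blockStep (i : I) (W : Submodule ℂ (QState (Site a b))) :
    GridGate a b → Submodule ℂ (QState (Site a b))
  | .T v => if β v = i then W.map (applyAtLin ![v] tMatrix) else W
  | .clifford₁ v U _ => if β v = i then W.map (applyAtLin ![v] U) else W
  | .clifford₂ u v _ U _ =>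
    if β u = i then
      if β v = i then W.map (applyAtLin ![u, v] U) else siteSpread u W
    else if β v = i then siteSpread v W else W

/-- The qubits with a neighbour in another block. -/
def boundarySites : Finset (Site a b) :=
  open Classical in Finset.univ.filter fun v => ∃ u, (gridGraph a b).Adj v u ∧ β u ≠ β v

/-- The boundary qubits of block `i`. -/
def blockBoundary (i : I) : Finset (Site a b) := (boundarySites β).filter fun v => β v = i

variable {β} {i : I}

theorem slice_applyAt_mem_single {V : Type} {β : V → I} {ψ : QState V}
    {W : Submodule ℂ (QState V)} (hψ : ∀ s, slice β ψ i s ∈ W) (v : V)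
    (U : Matrix (Fin 1 → Bool) (Fin 1 → Bool) ℂ) (s : V → Bool) :
    slice β (applyAt ![v] U ψ) i s ∈ if β v = i then W.map (applyAtLin ![v] U) else W := by
  have hw : Function.Injective ![v] := Function.injective_of_subsingleton _
  split_ifs with h
  · rw [slice_applyAt_of_forall_eq hw (by simpa using h)]
    exact Submodule.mem_map_of_mem (hψ _)
  · rw [slice_applyAt_of_forall_ne hw (by simpa using h)]
    exact Submodule.sum_mem _ fun t _ => Submodule.smul_mem _ _ (hψ _)

theorem GridGate.slice_apply_mem (g : GridGate a b) {ψ : QState (Site a b)}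
    {W : Submodule ℂ (QState (Site a b))} (hψ : ∀ s, slice β ψ i s ∈ W) (s : Site a b → Bool) :
    slice β (g.apply ψ) i s ∈ g.blockStep β i W := by
  cases g with
  | T v => exact slice_applyAt_mem_single hψ v tMatrix s
  | clifford₁ v U hU => exact slice_applyAt_mem_single hψ v U s
  | clifford₂ u v huv U hU =>
    have hw := injective_pair huv.ne
    simp only [GridGate.apply, GridGate.blockStep]
    split_ifs with h₁ h₂ h₂
    · rw [slice_applyAt_of_forall_eq hw (by simp [Fin.forall_fin_two, h₁, h₂])]
      exact Submodule.mem_map_of_mem (hψ _)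
    · exact slice_applyAt_mem_siteSpread hw 0 h₁ (by simp [Fin.forall_fin_two, h₂]) U hψ s
    · exact slice_applyAt_mem_siteSpread hw 1 h₂ (by simp [Fin.forall_fin_two, h₁]) U hψ s
    · rw [slice_applyAt_of_forall_ne hw (by simp [Fin.forall_fin_two, h₁, h₂])]
      exact Submodule.sum_mem _ fun t _ => Submodule.smul_mem _ _ (hψ _)

theorem mem_blockBoundary {u v : Site a b} (huv : (gridGraph a b).Adj v u) (hv : β v = i)
    (hu : β u ≠ i) : v ∈ blockBoundary β i := by
  simp only [blockBoundary, boundarySites, Finset.mem_filter, Finset.mem_univ, true_and]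
  exact ⟨⟨u, huv, hv ▸ hu⟩, hv⟩

theorem le_four_pow_mul (e r : ℕ) : r ≤ 4 ^ e * r :=
  Nat.le_mul_of_pos_left _ (by positivity)

/-- Only a gate crossing the boundary enlarges the space, and its qubit inside the block is then a
boundary site. Charging the factor 4 to that site lets the exponents be added over the disjoint
gates of a layer. -/
theorem GridGate.finrank_blockStep_le (g : GridGate a b) (W : Submodule ℂ (QState (Site a b))) :
    Module.finrank ℂ (g.blockStep β i W) ≤
      4 ^ (g.support ∩ blockBoundary β i).card * Module.finrank ℂ W := by
  have spread : ∀ {u : Site a b}, u ∈ g.support → u ∈ blockBoundary β i →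
      Module.finrank ℂ (siteSpread u W) ≤
        4 ^ (g.support ∩ blockBoundary β i).card * Module.finrank ℂ W := fun h h' =>
    (finrank_siteSpread_le _ W).trans <| Nat.mul_le_mul_right _ <|
      (pow_one 4).symm.le.trans <| Nat.pow_le_pow_right (by norm_num) <|
        Finset.card_pos.2 ⟨_, Finset.mem_inter.2 ⟨h, h'⟩⟩
  have image : ∀ f : QState (Site a b) →ₗ[ℂ] QState (Site a b), Module.finrank ℂ (W.map f) ≤
      4 ^ (g.support ∩ blockBoundary β i).card * Module.finrank ℂ W := fun f =>
    (Submodule.finrank_map_le f W).trans (le_four_pow_mul _ _)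
  have cases_le : ∀ {p : Prop} [Decidable p] {W₁ W₂ : Submodule ℂ (QState (Site a b))} {r : ℕ},
      (p → Module.finrank ℂ W₁ ≤ r) → (¬p → Module.finrank ℂ W₂ ≤ r) →
        Module.finrank ℂ (if p then W₁ else W₂ : Submodule ℂ (QState (Site a b))) ≤ r := by
    intro p _ W₁ W₂ r h₁ h₂
    by_cases h : p
    · rw [if_pos h]; exact h₁ h
    · rw [if_neg h]; exact h₂ h
  cases g with
  | T v => exact cases_le (fun _ => image _) fun _ => le_four_pow_mul _ _
  | clifford₁ v U hU => exact cases_le (fun _ => image _) fun _ => le_four_pow_mul _ _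
  | clifford₂ u v huv U hU =>
    refine cases_le (fun h₁ => cases_le (fun _ => image _) fun h₂ => ?_) fun h₁ =>
      cases_le (fun h₂ => ?_) fun _ => le_four_pow_mul _ _
    · exact spread (by simp [GridGate.support]) (mem_blockBoundary huv h₁ h₂)
    · exact spread (by simp [GridGate.support]) (mem_blockBoundary huv.symm h₂ h₁)

theorem sum_card_inter_le_of_pairwise_disjoint {α ι : Type*} [DecidableEq α] (f : ι → Finset α)
    (l : List ι) (hl : l.Pairwise fun g h => Disjoint (f g) (f h)) (S : Finset α) :
    (l.map fun g => (f g ∩ S).card).sum ≤ S.card := by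
  induction l generalizing S with
  | nil => simp
  | cons g l ih =>
    rw [List.pairwise_cons] at hl
    -- The later sets miss `f g`, so they meet `S` and `S \ f g` equally.
    have h₁ : (l.map fun h => (f h ∩ S).card) = l.map fun h => (f h ∩ (S \ f g)).card := by
      refine List.map_congr_left fun h hh => ?_
      congr 1
      ext v
      have : v ∈ f g → v ∉ f h := fun hv => Finset.disjoint_left.1 (hl.1 h hh) hv
      simp only [Finset.mem_inter, Finset.mem_sdiff]
      tauto
    have h₂ := ih hl.2 (S \ f g)
    have h₃ := Finset.card_inter_add_card_sdiff S (f g)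
    rw [List.map_cons, List.sum_cons, h₁, Finset.inter_comm]
    omega

variable (β i) in
/-- `GridGate.blockStep` along all gates of a layer. -/
def GridLayer.blockStep (W : Submodule ℂ (QState (Site a b))) (L : GridLayer a b) :
    Submodule ℂ (QState (Site a b)) :=
  L.gates.foldl (GridGate.blockStep β i) W

variable (β i) in
/-- `GridGate.blockStep` along all gates of a circuit. -/
def GridCircuit.blockStep (W : Submodule ℂ (QState (Site a b))) (Q : GridCircuit a b) :
    Submodule ℂ (QState (Site a b)) :=
  Q.layers.foldl (GridLayer.blockStep β i) W

theorem GridLayer.slice_apply_mem (L : GridLayer a b) {ψ : QState (Site a b)}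
    {W : Submodule ℂ (QState (Site a b))} (hψ : ∀ s, slice β ψ i s ∈ W) :
    ∀ s, slice β (L.apply ψ) i s ∈ L.blockStep β i W := by
  unfold GridLayer.apply GridLayer.blockStep
  induction L.gates generalizing ψ W with
  | nil => exact hψ
  | cons g l ih => exact ih (g.slice_apply_mem hψ)

theorem GridCircuit.slice_apply_mem (Q : GridCircuit a b) {ψ : QState (Site a b)}
    {W : Submodule ℂ (QState (Site a b))} (hψ : ∀ s, slice β ψ i s ∈ W) :
    ∀ s, slice β (Q.apply ψ) i s ∈ Q.blockStep β i W := by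
  unfold GridCircuit.apply GridCircuit.blockStep
  induction Q.layers generalizing ψ W with
  | nil => exact hψ
  | cons L l ih => exact ih (L.slice_apply_mem hψ)

theorem GridLayer.finrank_blockStep_le (L : GridLayer a b)
    (W : Submodule ℂ (QState (Site a b))) :
    Module.finrank ℂ (L.blockStep β i W) ≤
      4 ^ (blockBoundary β i).card * Module.finrank ℂ W := by
  have key : ∀ (l : List (GridGate a b)) (W : Submodule ℂ (QState (Site a b))),
      Module.finrank ℂ (l.foldl (GridGate.blockStep β i) W : Submodule ℂ (QState (Site a b))) ≤
        4 ^ (l.map fun g => (g.support ∩ blockBoundary β i).card).sum * Module.finrank ℂ W := by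
    intro l
    induction l with
    | nil => exact fun W => le_four_pow_mul _ _
    | cons g l ih =>
      intro W
      rw [List.foldl_cons, List.map_cons, List.sum_cons, add_comm, pow_add, mul_assoc]
      exact (ih _).trans (Nat.mul_le_mul_left _ (g.finrank_blockStep_le W))
  exact (key L.gates W).trans <| Nat.mul_le_mul_right _ <| Nat.pow_le_pow_right (by norm_num) <|
    sum_card_inter_le_of_pairwise_disjoint _ _ L.disjoint _

theorem GridCircuit.finrank_blockStep_le (Q : GridCircuit a b)
    (W : Submodule ℂ (QState (Site a b))) :
    Module.finrank ℂ (Q.blockStep β i W) ≤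
      4 ^ (Q.depth * (blockBoundary β i).card) * Module.finrank ℂ W := by
  unfold GridCircuit.blockStep GridCircuit.depth
  induction Q.layers generalizing W with
  | nil => exact le_four_pow_mul _ _
  | cons L l ih =>
    rw [List.foldl_cons, List.length_cons, add_mul, one_mul, pow_add, mul_assoc]
    exact (ih _).trans (Nat.mul_le_mul_left _ (L.finrank_blockStep_le W))

/-- The span of the basis state of block `i` with bits `z`. -/
def ketSpace {V : Type} (β : V → I) (i : I) (z : V → Bool) : Submodule ℂ (QState V) :=
  Submodule.span ℂ {fun y => open Classical in if ∀ v, β v = i → y v = z v then 1 else 0}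

omit [DecidableEq I] in
theorem finrank_ketSpace_le {V : Type} (β : V → I) (i : I) (z : V → Bool) :
    Module.finrank ℂ (ketSpace β i z) ≤ 1 :=
  (finrank_span_le_card _).trans (by simp)

-- Source of locality: the space attached to a block sees only the input bits of that block.
omit [DecidableEq I] in
theorem ketSpace_congr {V : Type} {β : V → I} {i : I} {z z' : V → Bool}
    (h : ∀ v, β v = i → z v = z' v) : ketSpace β i z = ketSpace β i z' := by
  unfold ketSpace
  congr 2
  funext y
  congr 1
  exact propext (forall_congr' fun v => imp_congr_right fun hv => by rw [h v hv])

/-- The input is a product state: its slice is the basis vector of the block if the outer bits are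
the right ones, and zero otherwise. -/
theorem slice_inputKet_mem {V : Type} [Fintype V] {n : ℕ} (β : V → I) (i : I) (inp : Fin n ↪ V)
    (x : Fin n → Bool) (s : V → Bool) :
    slice β (inputKet inp x) i s ∈ ketSpace β i (Function.extend inp x fun _ => false) := by
  classical
  set z : V → Bool := Function.extend inp x fun _ => false
  refine Submodule.mem_span_singleton.2 ⟨if ∀ v, β v ≠ i → s v = z v then 1 else 0, ?_⟩
  funext y
  have : mix β i y s = z ↔ (∀ v, β v ≠ i → s v = z v) ∧ ∀ v, β v = i → y v = z v := by
    rw [funext_iff, ← forall_and]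
    refine forall_congr' fun v => ?_
    by_cases hv : β v = i <;> simp [mix, hv]
  simp only [slice, inputKet, Pi.smul_apply, smul_eq_mul]
  rw [show Function.extend inp x (fun _ => false) = z from rfl, if_congr this rfl rfl]
  rw [ite_and, ite_mul, one_mul, zero_mul]
  congr

end BlockSpace

/-! ### Separating coordinates -/

/-- The coordinate functionals restricted to `W` contain a basis of their span, with at most
`finrank W` elements. A vector killed by this basis is killed by every coordinate, so it vanishes.
Unused indices in `κ` receive an arbitrary point. -/
theorem exists_separating {Y κ : Type} [Finite Y] [Nonempty Y] [Finite κ]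
    (W : Submodule ℂ (Y → ℂ)) (h : Module.finrank ℂ W ≤ Nat.card κ) :
    ∃ f : κ → Y, ∀ w ∈ W, (∀ q, w (f q) = 0) → w = 0 := by
  classical
  let L : Y → Module.Dual ℂ W := fun y => (LinearMap.proj y).comp W.subtype
  obtain ⟨b, hb, hspan, hli⟩ := exists_linearIndependent ℂ (Set.range L)
  have : Fintype b := ((Set.finite_range L).subset hb).fintype
  have : Fintype κ := Fintype.ofFinite κ
  have hcard : Fintype.card b ≤ Fintype.card κ := by
    rw [Nat.card_eq_fintype_card] at h
    exact (hli.fintype_card_le_finrank.trans_eq Subspace.dual_finrank_eq).trans h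
  obtain ⟨e⟩ := Function.Embedding.nonempty_of_card_le hcard
  choose g hg using fun x : b => hb x.2
  refine ⟨Function.extend e g fun _ => Classical.arbitrary Y, fun w hw hq => funext fun y => ?_⟩
  have hker : Submodule.span ℂ b ≤ LinearMap.ker (LinearMap.applyₗ (⟨w, hw⟩ : W)) := by
    refine Submodule.span_le.2 fun x hx => ?_
    have := hq (e ⟨x, hx⟩)
    rw [e.injective.extend_apply] at this
    rw [SetLike.mem_coe, LinearMap.mem_ker, LinearMap.applyₗ_apply_apply, show x = L _ from (hg ⟨x, hx⟩).symm]
    exact this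
  have hy : L y ∈ Submodule.span ℂ b := hspan ▸ Submodule.subset_span ⟨y, rfl⟩
  exact LinearMap.mem_ker.1 (hker hy)

/-- Separating sets multiply as in a tensor product: if all amplitudes at products of separating
strings vanished, the blocks could be freed one at a time, each slice being zero because it vanishes
on its separating set. -/
theorem exists_ne_zero_of_slices {V I : Type} [Finite V] [DecidableEq I] (β : V → I)
    {κ : I → Type} [∀ i, Nonempty (κ i)] (f : ∀ i, κ i → V → Bool)
    (W : I → Submodule ℂ (QState V))
    (hf : ∀ i, ∀ w ∈ W i, (∀ q, w (f i q) = 0) → w = 0) {ψ : QState V} (hψ : ψ ≠ 0)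
    (hs : ∀ i s, slice β ψ i s ∈ W i) :
    ∃ r : ∀ i, κ i, ψ (fun v => f (β v) (r (β v)) v) ≠ 0 := by
  by_contra! hr
  -- `J` is the set of blocks where `s` is arbitrary; on all others it is a separating string.
  have key : ∀ (J : Finset I) (s : V → Bool),
      (∀ i, i ∉ J → ∃ q, ∀ v, β v = i → s v = f i q v) → ψ s = 0 := by
    intro J
    induction J using Finset.induction_on with
    | empty =>
      intro s h
      choose q hq using fun i => h i (Finset.notMem_empty i)
      rw [← hr q]
      exact congrArg ψ (funext fun v => hq _ v rfl)
    | insert j J _ ih =>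
      intro s h
      have h₀ : slice β ψ j s = 0 := by
        refine hf j _ (hs j s) fun q => ih _ fun i hi => ?_
        by_cases hij : i = j
        · subst hij
          exact ⟨q, fun v hv => by simp [mix, hv]⟩
        · obtain ⟨q', hq'⟩ := h i (by simp [hij, hi])
          exact ⟨q', fun v hv => by simp [mix, hv, hij, hq' v hv]⟩
      have := congrFun h₀ s
      rwa [slice, show mix β j s s = s from funext fun v => ite_self _] at this
  have := Fintype.ofFinite V
  exact hψ <| funext fun s => key (Finset.univ.image β) s fun i hi =>
    ⟨Classical.arbitrary _, fun v hv =>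
      absurd (hv ▸ Finset.mem_image_of_mem β (Finset.mem_univ v)) hi⟩

/-! ### Classical circuits for functions of few bits -/

section Networks

variable {k : ℕ}

/-- `P'` contains all wires of `P`. -/
def Network.Extends {w w' : ℕ} (P : Network k w) (P' : Network k w') : Prop :=
  ∃ ι : Fin w → Fin w', ∀ i, (∀ z, P'.eval z (ι i) = P.eval z i) ∧ P'.wireDepth (ι i) = P.wireDepth i

theorem Network.Extends.refl {w : ℕ} (P : Network k w) : P.Extends P :=
  ⟨id, fun _ => ⟨fun _ => rfl, rfl⟩⟩

theorem Network.Extends.trans {w w' w'' : ℕ} {P : Network k w} {P' : Network k w'}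
    {P'' : Network k w''} (h : P.Extends P') (h' : P'.Extends P'') : P.Extends P'' := by
  obtain ⟨ι, hι⟩ := h
  obtain ⟨ι', hι'⟩ := h'
  exact ⟨ι' ∘ ι, fun i => ⟨fun z => ((hι' _).1 z).trans ((hι i).1 z), (hι' _).2.trans (hι i).2⟩⟩

theorem Network.extends_snoc {w : ℕ} (P : Network k w) (g : BoolGate w) : P.Extends (P.snoc g) :=
  ⟨Fin.castSucc, fun i => ⟨fun z => by simp [Network.eval], by simp [Network.wireDepth]⟩⟩

/-- Some wire of `P` of depth at most `e` computes `F`. -/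
def Network.Computes {w : ℕ} (P : Network k w) (F : (Fin k → Bool) → Bool) (e : ℕ) : Prop :=
  ∃ i, (∀ z, P.eval z i = F z) ∧ P.wireDepth i ≤ e

theorem Network.Computes.of_extends {w w' : ℕ} {P : Network k w} {P' : Network k w'}
    {F : (Fin k → Bool) → Bool} {e : ℕ} (h : P.Computes F e) (hP : P.Extends P') :
    P'.Computes F e := by
  obtain ⟨i, hi, hd⟩ := h
  obtain ⟨ι, hι⟩ := hP
  exact ⟨ι i, fun z => ((hι i).1 z).trans (hi z), (hι i).2.trans_le hd⟩

/-- `P` can be extended, within depth `D`, by a wire of depth at most `e` that computes `F`. -/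
def Network.Extendable {w : ℕ} (P : Network k w) (D : ℕ) (F : (Fin k → Bool) → Bool) (e : ℕ) :
    Prop :=
  ∃ (w' : ℕ) (P' : Network k w'), P.Extends P' ∧ (∀ i, P'.wireDepth i ≤ D) ∧ P'.Computes F e

theorem Network.extendable_snoc {w : ℕ} {P : Network k w} {D e : ℕ}
    {F : (Fin k → Bool) → Bool} (hP : ∀ i, P.wireDepth i ≤ D) (g : BoolGate w)
    (hF : ∀ z, g.eval (P.eval z) = F z) (he : g.depth P.wireDepth ≤ e) (heD : e ≤ D) :
    P.Extendable D F e := by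
  refine ⟨w + 1, P.snoc g, P.extends_snoc g, fun i => ?_, Fin.last w, fun z => ?_, ?_⟩
  · refine Fin.lastCases ?_ (fun i => ?_) i
    · simpa [Network.wireDepth] using he.trans heD
    · simpa [Network.wireDepth] using hP i
  · simpa [Network.eval] using hF z
  · simpa [Network.wireDepth] using he

theorem Network.inputs_extends {w : ℕ} (P : Network k w) : Network.inputs.Extends P := by
  induction P with
  | inputs => exact .refl _
  | snoc P g ih => exact ih.trans (P.extends_snoc g)

theorem Network.computes_input {w : ℕ} (P : Network k w) (i : Fin k) :
    P.Computes (fun z => z i) 0 :=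
  Network.Computes.of_extends ⟨i, fun _ => rfl, le_rfl⟩ P.inputs_extends

/-- Shannon expansion in one variable `a`: `F` is `(a ∧ F|a=1) ∨ (¬a ∧ F|a=0)`, costing at most
three levels per variable. The cap `D` on all wires is carried along because the depth of a circuit
is taken over all of its wires. -/
theorem Network.extendable_of_dependsOn {D : ℕ} (S : Finset (Fin k)) {F : (Fin k → Bool) → Bool}
    (hF : DependsOn F (S : Set (Fin k))) (hD : 3 * S.card ≤ D) {w : ℕ} (P : Network k w)
    (hP : ∀ i, P.wireDepth i ≤ D) : P.Extendable D F (3 * S.card) := by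
  induction S using Finset.induction_on generalizing F w with
  | empty =>
    exact P.extendable_snoc hP (.const (F fun _ => false)) (fun z => hF (by simp))
      (by simp [BoolGate.depth]) hD
  | insert a S ha ih =>
    rw [Finset.card_insert_of_notMem ha] at hD ⊢
    have hdep : ∀ v, DependsOn (fun z => F (Function.update z a v)) (S : Set (Fin k)) := by
      intro v z z' h
      refine hF fun i hi => ?_
      by_cases hia : i = a
      · subst hia; simp
      · simp only [Function.update_of_ne hia]
        exact h i (by simpa [hia] using hi)
    obtain ⟨w₁, P₁, hE₁, hP₁, h₁⟩ := ih (hdep true) (by omega) P hP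
    obtain ⟨w₂, P₂, hE₂, hP₂, h₂⟩ := ih (hdep false) (by omega) P₁ hP₁
    obtain ⟨i, hi, hid⟩ := P₂.computes_input a
    obtain ⟨w₃, P₃, hE₃, hP₃, h₃⟩ := P₂.extendable_snoc (F := fun z => !(z a)) (e := 1) hP₂ (.not i)
      (fun z => by simp [BoolGate.eval, hi]) (by simp [BoolGate.depth]; omega) (by omega)
    obtain ⟨i, hi, hid⟩ := P₃.computes_input a
    obtain ⟨j, hj, hjd⟩ := (h₁.of_extends hE₂).of_extends hE₃
    obtain ⟨w₄, P₄, hE₄, hP₄, h₄⟩ := P₃.extendable_snoc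
      (F := fun z => z a && F (Function.update z a true)) (e := 3 * S.card + 1) hP₃ (.and i j)
      (fun z => by simp [BoolGate.eval, hi, hj]) (by simp [BoolGate.depth]; omega) (by omega)
    obtain ⟨i, hi, hid⟩ := h₃.of_extends hE₄
    obtain ⟨j, hj, hjd⟩ := (h₂.of_extends hE₃).of_extends hE₄
    -- The slack `+ 2` pays for the negation, which has depth 1 even when `S` is empty.
    obtain ⟨w₅, P₅, hE₅, hP₅, h₅⟩ := P₄.extendable_snoc
      (F := fun z => !(z a) && F (Function.update z a false)) (e := 3 * S.card + 2) hP₄ (.and i j)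
      (fun z => by simp [BoolGate.eval, hi, hj]) (by simp [BoolGate.depth]; omega) (by omega)
    obtain ⟨i, hi, hid⟩ := h₄.of_extends hE₅
    obtain ⟨j, hj, hjd⟩ := h₅
    obtain ⟨w₆, P₆, hE₆, hP₆, h₆⟩ := P₅.extendable_snoc (F := F) (e := 3 * (S.card + 1)) hP₅ (.or i j)
      (fun z => by
        simp only [BoolGate.eval, hi, hj]
        have hu := Function.update_eq_self a z
        cases hz : z a <;> rw [hz] at hu <;> simp [hu])
      (by simp [BoolGate.depth]; omega) (by omega)
    exact ⟨w₆, P₆, ((((hE₁.trans hE₂).trans hE₃).trans hE₄).trans hE₅).trans hE₆, hP₆, h₆⟩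

theorem Network.exists_computing {D m : ℕ} (F : Fin m → (Fin k → Bool) → Bool)
    (S : Fin m → Finset (Fin k)) (hF : ∀ j, DependsOn (F j) (S j : Set (Fin k)))
    (hD : ∀ j, 3 * (S j).card ≤ D) :
    ∃ (w : ℕ) (P : Network k w), (∀ i, P.wireDepth i ≤ D) ∧
      ∃ o : Fin m → Fin w, ∀ z j, P.eval z (o j) = F j z := by
  have key : ∀ J : Finset (Fin m), ∃ (w : ℕ) (P : Network k w), (∀ i, P.wireDepth i ≤ D) ∧
      ∀ j ∈ J, P.Computes (F j) D := by
    intro J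
    induction J using Finset.induction_on with
    | empty => exact ⟨k, .inputs, fun _ => Nat.zero_le _, by simp⟩
    | insert j J hj ih =>
      obtain ⟨w, P, hP, hJ⟩ := ih
      obtain ⟨w', P', hE, hP', i, hi, hd⟩ := P.extendable_of_dependsOn (S j) (hF j) (hD j) hP
      refine ⟨w', P', hP', fun j' hj' => ?_⟩
      rcases Finset.mem_insert.1 hj' with rfl | hj'
      · exact ⟨i, hi, hd.trans (hD _)⟩
      · exact (hJ j' hj').of_extends hE
  obtain ⟨w, P, hP, h⟩ := key Finset.univ
  choose o ho using fun j => h j (Finset.mem_univ j)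
  exact ⟨w, P, hP, o, fun z j => (ho j).1 z⟩

end Networks

/-! ### Randomized circuits from local functions and coins -/

theorem RandCircuit.successProb_ge {n m : ℕ} (C : RandCircuit n m)
    (R : (Fin n → Bool) → (Fin m → Bool) → Bool) (x : Fin n → Bool)
    (h : ∃ r, R x (C.run x r) = true) : 1 / 2 ^ C.coins ≤ C.successProb R x := by
  obtain ⟨r, hr⟩ := h
  unfold RandCircuit.successProb
  gcongr
  exact_mod_cast Finset.card_pos.2 ⟨r, by simpa using hr⟩

theorem exists_randCircuit {n m D : ℕ} {κ : Type} [Fintype κ]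
    (F : (Fin n → Bool) → (κ → Bool) → Fin m → Bool) (S : Fin m → Finset (Fin n))
    (T : Fin m → Finset κ)
    (hF : ∀ j x x' r r', (∀ i ∈ S j, x i = x' i) → (∀ q ∈ T j, r q = r' q) → F x r j = F x' r' j)
    (hD : ∀ j, 3 * ((S j).card + (T j).card) ≤ D) :
    ∃ C : RandCircuit n m, C.coins = Fintype.card κ ∧ C.depth ≤ D ∧
      ∀ x r, ∃ r', C.run x r' = F x r := by
  let e : κ ≃ Fin (Fintype.card κ) := Fintype.equivFin κ
  let S' : Fin m → Finset (Fin (n + Fintype.card κ)) := fun j =>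
    ((S j).disjSum (T j)).map ((Equiv.sumCongr (Equiv.refl _) e).trans finSumFinEquiv).toEmbedding
  obtain ⟨w, P, hP, o, ho⟩ := Network.exists_computing (D := D)
    (fun j z => F (fun i => z (Fin.castAdd _ i)) (fun q => z (Fin.natAdd n (e q))) j) S'
    (fun j z z' h => hF j _ _ _ _
      (fun i hi => h _ (Finset.mem_coe.2 (Finset.mem_map.2 ⟨.inl i, by simpa using hi, by simp⟩)))
      (fun q hq => h _ (Finset.mem_coe.2 (Finset.mem_map.2 ⟨.inr q, by simpa using hq, by simp⟩))))
    (fun j => by simpa [S'] using hD j)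
  refine ⟨⟨_, w, P, o⟩, rfl, Finset.sup_le fun i _ => hP i, fun x r => ⟨fun q => r (e.symm q), ?_⟩⟩
  funext j
  simp [RandCircuit.run, ho]

/-- The circuit that outputs `m` random bits. -/
def randomOutput (n m : ℕ) : RandCircuit n m := ⟨m, n + m, .inputs, Fin.natAdd n⟩

theorem randomOutput_run (n m : ℕ) (x : Fin n → Bool) (r : Fin m → Bool) :
    (randomOutput n m).run x r = r := by
  funext j
  simp [RandCircuit.run, randomOutput, Network.eval]

theorem randomOutput_depth (n m : ℕ) : (randomOutput n m).depth = 0 := by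
  simp [RandCircuit.depth, randomOutput, Network.wireDepth]

/-! ### Square blocks of the grid -/

/-- The index of the `ℓ × ℓ` block that contains a site. -/
def squareBlock {a b : ℕ} (ℓ : ℕ) (v : Site a b) : ℕ × ℕ := (v.1 / ℓ, v.2 / ℓ)

theorem card_filter_div_eq_le {a ℓ : ℕ} (hℓ : 0 < ℓ) (p : ℕ) :
    (Finset.univ.filter fun x : Fin a => (x : ℕ) / ℓ = p).card ≤ ℓ := by
  calc _ ≤ (Finset.Ico (p * ℓ) (p * ℓ + ℓ)).card := by
        refine Finset.card_le_card_of_injOn (fun x => (x : ℕ)) (fun x hx => ?_)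
          Fin.val_injective.injOn
        have := (Nat.div_eq_iff hℓ).1 (Finset.mem_filter.1 hx).2
        simp only [Finset.coe_Ico, Set.mem_Ico]
        omega
    _ = ℓ := by simp

theorem card_squareBlock_le {a b ℓ : ℕ} (hℓ : 0 < ℓ) (i : ℕ × ℕ) :
    (Finset.univ.filter fun v : Site a b => squareBlock ℓ v = i).card ≤ ℓ ^ 2 := by
  have : (Finset.univ.filter fun v : Site a b => squareBlock ℓ v = i) =
      (Finset.univ.filter fun x : Fin a => (x : ℕ) / ℓ = i.1) ×ˢ
        (Finset.univ.filter fun x : Fin b => (x : ℕ) / ℓ = i.2) := by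
    ext v
    simp [squareBlock, Prod.ext_iff]
  rw [this, Finset.card_product, sq]
  exact Nat.mul_le_mul (card_filter_div_eq_le hℓ _) (card_filter_div_eq_le hℓ _)

/-- The positions on a path with a neighbour in another interval of length `ℓ`. -/
def pathBoundary (a ℓ : ℕ) : Finset (Fin a) :=
  open Classical in Finset.univ.filter fun x =>
    ∃ y, (SimpleGraph.pathGraph a).Adj x y ∧ (y : ℕ) / ℓ ≠ (x : ℕ) / ℓ

/-- A boundary position is a multiple of `ℓ` in `(0, a]` or the predecessor of one, and there are at
most `a / ℓ` such multiples. -/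
theorem card_pathBoundary_mul_le {a ℓ : ℕ} : (pathBoundary a ℓ).card * ℓ ≤ 2 * a := by
  classical
  let M := (Finset.Ioc 0 a).filter fun y => ℓ ∣ y
  have hM : M.card * ℓ ≤ a := by
    rw [Nat.Ioc_filter_dvd_card_eq_div]
    exact Nat.div_mul_le_self a ℓ
  have hsub : (pathBoundary a ℓ).image Fin.val ⊆ M ∪ M.image fun y => y - 1 := by
    intro z hz
    obtain ⟨x, hx, rfl⟩ := Finset.mem_image.1 hz
    obtain ⟨y, hy, hne⟩ := (Finset.mem_filter.1 hx).2
    have hy' := y.2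
    have hx' := x.2
    rw [SimpleGraph.pathGraph_adj] at hy
    rcases hy with hy | hy
    · refine Finset.mem_union_right _ (Finset.mem_image.2 ⟨y, ?_, by omega⟩)
      refine Finset.mem_filter.2 ⟨Finset.mem_Ioc.2 (by omega), ?_⟩
      by_contra hd
      rw [← hy] at hd hne
      exact hne (by rw [Nat.succ_div, if_neg hd, add_zero])
    · refine Finset.mem_union_left _ ?_
      refine Finset.mem_filter.2 ⟨Finset.mem_Ioc.2 (by omega), ?_⟩
      by_contra hd
      rw [← hy] at hd hne
      exact hne (by rw [Nat.succ_div, if_neg hd, add_zero])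
  have := Finset.card_le_card hsub
  rw [Finset.card_image_of_injective _ Fin.val_injective] at this
  have h₁ := Finset.card_union_le M (M.image fun y => y - 1)
  have h₂ := Finset.card_image_le (s := M) (f := fun y => y - 1)
  calc _ ≤ (2 * M.card) * ℓ := Nat.mul_le_mul_right _ (by omega)
    _ ≤ 2 * a := by rw [mul_assoc]; exact Nat.mul_le_mul_left _ hM

theorem card_boundarySites_mul_le {a b ℓ : ℕ} :
    (boundarySites (squareBlock ℓ : Site a b → ℕ × ℕ)).card * ℓ ≤ 4 * (a * b) := by
  classical
  have hsub : boundarySites (squareBlock ℓ : Site a b → ℕ × ℕ) ⊆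
      (pathBoundary a ℓ) ×ˢ Finset.univ ∪ Finset.univ ×ˢ (pathBoundary b ℓ) := by
    intro v hv
    obtain ⟨u, huv, hne⟩ := (Finset.mem_filter.1 hv).2
    simp only [Finset.mem_union, Finset.mem_product, Finset.mem_univ, and_true, true_and,
      pathBoundary, Finset.mem_filter]
    rcases SimpleGraph.boxProd_adj.1 huv with ⟨h, h'⟩ | ⟨h, h'⟩
    · exact Or.inl ⟨u.1, h, fun e => hne (by simp [squareBlock, e, h'])⟩
    · exact Or.inr ⟨u.2, h, fun e => hne (by simp [squareBlock, e, h'])⟩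
  have h := (Finset.card_le_card hsub).trans (Finset.card_union_le _ _)
  rw [Finset.card_product, Finset.card_product, Finset.card_univ, Finset.card_univ,
    Fintype.card_fin, Fintype.card_fin] at h
  have ha := Nat.mul_le_mul_right b (card_pathBoundary_mul_le (a := a) (ℓ := ℓ))
  have hb := Nat.mul_le_mul_right a (card_pathBoundary_mul_le (a := b) (ℓ := ℓ))
  nlinarith [Nat.mul_le_mul_right ℓ h]

/-! ### The simulation -/

/-- An output bit reads at most `ℓ ^ 2` inputs and, bounding the boundary of its block crudely by
the whole block, at most `2 * d * ℓ ^ 2` coins. At three levels per bit this is the stated depth. -/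
theorem exists_simulation {a b n m d ℓ : ℕ} (Q : GridCircuit a b) (hd : Q.depth ≤ d)
    (inp : Fin n ↪ Site a b) (out : Fin m ↪ Site a b) (hℓ : 0 < ℓ) :
    ∃ C : RandCircuit n m, C.depth ≤ 3 * (1 + 2 * d) * ℓ ^ 2 ∧
      C.coins * ℓ ≤ 8 * d * (a * b) ∧ ∀ x, ∃ r, Q.Outputs inp out x (C.run x r) := by
  classical
  let β : Site a b → ℕ × ℕ := squareBlock ℓ
  -- Each boundary site contributes a factor `4 ^ d = 2 ^ (2 * d)` to the dimension, hence `2 * d`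
  -- coins.
  let κ := boundarySites β × Fin (2 * d)
  let ρ : ℕ × ℕ → Type := fun i => {q : κ // β q.1 = i}
  let W : ℕ × ℕ → (Fin n → Bool) → Submodule ℂ (QState (Site a b)) := fun i x =>
    Q.blockStep β i (ketSpace β i (Function.extend inp x fun _ => false))
  have hρ : ∀ i, Fintype.card (ρ i) = (blockBoundary β i).card * (2 * d) := by
    intro i
    let e : ρ i ≃ blockBoundary β i × Fin (2 * d) :=
      { toFun := fun q => (⟨q.1.1, Finset.mem_filter.2 ⟨q.1.1.2, q.2⟩⟩, q.1.2)
        invFun := fun p => ⟨(⟨p.1, (Finset.mem_filter.1 p.1.2).1⟩, p.2),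
          (Finset.mem_filter.1 p.1.2).2⟩
        left_inv := fun _ => rfl
        right_inv := fun _ => rfl }
    rw [Fintype.card_congr e, Fintype.card_prod, Fintype.card_coe, Fintype.card_fin]
  have hW : ∀ i x, Module.finrank ℂ (W i x) ≤ Nat.card (ρ i → Bool) := by
    intro i x
    rw [Nat.card_eq_fintype_card, Fintype.card_fun, Fintype.card_bool, hρ]
    calc _ ≤ 4 ^ (Q.depth * (blockBoundary β i).card) * 1 :=
          (Q.finrank_blockStep_le _).trans (Nat.mul_le_mul_left _ (finrank_ketSpace_le _ _ _))
      _ ≤ 4 ^ (d * (blockBoundary β i).card) := by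
          rw [mul_one]
          exact Nat.pow_le_pow_right (by norm_num) (Nat.mul_le_mul_right _ hd)
      _ = 2 ^ ((blockBoundary β i).card * (2 * d)) := by
          rw [show 4 = 2 ^ 2 from rfl, ← pow_mul]
          congr 1
          ring
  -- The dimension bound is put after the existential so that `f` can be chosen as a function of the
  -- subspace alone: inputs with the same block space get the same separating strings.
  have hsep : ∀ (i : ℕ × ℕ) (W : Submodule ℂ (QState (Site a b))),
      ∃ f : (ρ i → Bool) → Site a b → Bool, Module.finrank ℂ W ≤ Nat.card (ρ i → Bool) →
        ∀ w ∈ W, (∀ q, w (f q) = 0) → w = 0 := by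
    intro i W
    by_cases h : Module.finrank ℂ W ≤ Nat.card (ρ i → Bool)
    · obtain ⟨f, hf⟩ := exists_separating W h
      exact ⟨f, fun _ => hf⟩
    · exact ⟨fun _ _ => false, fun h' => absurd h' h⟩
  choose f hf using hsep
  have hblock : ∀ i, (Finset.univ.filter fun v => β v = i).card ≤ ℓ ^ 2 :=
    fun i => card_squareBlock_le hℓ i
  have hbd : ∀ i, (blockBoundary β i).card ≤ ℓ ^ 2 := fun i =>
    (Finset.card_le_card (Finset.filter_subset_filter _ (Finset.subset_univ _))).trans (hblock i)
  obtain ⟨C, hC, hCd, hrun⟩ := exists_randCircuit (D := 3 * (1 + 2 * d) * ℓ ^ 2)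
    (fun x (r : κ → Bool) j =>
      f (β (out j)) (W (β (out j)) x) (fun q => r q.1) (out j))
    (fun j => Finset.univ.filter fun k => β (inp k) = β (out j))
    (fun j => Finset.univ.filter fun q : κ => β q.1 = β (out j))
    (by
      intro j x x' r r' hx hr
      have h₁ : W (β (out j)) x = W (β (out j)) x' := by
        refine congrArg (Q.blockStep β _) (ketSpace_congr fun v hv => ?_)
        by_cases h : ∃ k, inp k = v
        · obtain ⟨k, rfl⟩ := h
          rw [inp.injective.extend_apply, inp.injective.extend_apply]
          exact hx k (by simpa using hv)
        · rw [Function.extend_apply' _ _ _ h, Function.extend_apply' _ _ _ h]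
      have h₂ : (fun q : ρ (β (out j)) => r q.1) = fun q => r' q.1 :=
        funext fun q => hr q.1 (by simpa using q.2)
      simp only [h₁, h₂])
    (by
      intro j
      have h₁ : (Finset.univ.filter fun k => β (inp k) = β (out j)).card ≤ ℓ ^ 2 :=
        (Finset.card_le_card_of_injOn inp (fun k hk => by simpa using hk)
          inp.injective.injOn).trans (hblock (β (out j)))
      have h₂ : (Finset.univ.filter fun q : κ => β q.1 = β (out j)).card ≤ ℓ ^ 2 * (2 * d) := by
        rw [← Fintype.card_subtype]
        exact (hρ (β (out j))).trans_le (Nat.mul_le_mul_right _ (hbd _))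
      nlinarith)
  refine ⟨C, hCd, ?_, fun x => ?_⟩
  · rw [hC, Fintype.card_prod, Fintype.card_coe, Fintype.card_fin]
    have := Nat.mul_le_mul_left (2 * d) (card_boundarySites_mul_le (a := a) (b := b) (ℓ := ℓ))
    calc _ = 2 * d * ((boundarySites β).card * ℓ) := by ring
      _ ≤ 2 * d * (4 * (a * b)) := this
      _ = _ := by ring
  · obtain ⟨r, hr⟩ := exists_ne_zero_of_slices β (fun i => f i (W i x)) (fun i => W i x)
      (fun i => hf i _ (hW i x)) (Q.apply_ne_zero (inputKet_ne_zero inp x))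
      (fun i => Q.slice_apply_mem (slice_inputKet_mem β i inp x))
    obtain ⟨r', hr'⟩ := hrun x fun q => r (β q.1) ⟨q, rfl⟩
    refine ⟨r', _, fun j => ?_, hr⟩
    rw [hr']
    -- The choices per block were glued into one global coin string; restricting it to a block
    -- returns the original choice, up to transport along the equality of blocks.
    have : r (β (out j)) = fun q : ρ (β (out j)) => r (β q.1.1) ⟨q.1, rfl⟩ := by
      funext q
      obtain ⟨q, hq⟩ := q
      revert hq
      generalize β (out j) = i
      rintro rfl
      rfl
    rw [this]

/-- One good coin string has probability `2 ^ (-coins)`, and `2 ≤ e`. -/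
theorem exp_neg_le_successProb {n m : ℕ} (C : RandCircuit n m)
    (R : (Fin n → Bool) → (Fin m → Bool) → Bool) (x : Fin n → Bool)
    (h : ∃ r, R x (C.run x r) = true) {t : ℝ} (ht : (C.coins : ℝ) ≤ t) :
    Real.exp (-t) ≤ C.successProb R x := by
  refine le_trans ?_ (C.successProb_ge R x h)
  have h₂ : (2 : ℝ) ≤ Real.exp 1 := by linarith [Real.add_one_le_exp (1 : ℝ)]
  calc Real.exp (-t) ≤ Real.exp (-(C.coins : ℝ)) := Real.exp_le_exp.2 (neg_le_neg ht)
    _ = 1 / Real.exp 1 ^ C.coins := by rw [← Real.exp_nat_mul, mul_one, Real.exp_neg, one_div]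
    _ ≤ 1 / 2 ^ C.coins := by gcongr

end ShallowGrid

end

/-! ### Choice of the block size -/

theorem mainTheorem4 :
    ∃ γ : ℝ → ℝ, ∀ d A : ℕ, ∃ K : ℝ, ∀ c : ℝ, 0 < c →
      ∀ (n m : ℕ), 2 ≤ n → ∀ R : (Fin n → Bool) → (Fin m → Bool) → Bool,
        ShallowGrid.DefinedOnGrid d (A * n) R →
        ∃ C : ShallowGrid.RandCircuit n m,
          (C.depth : ℝ) ≤ c * Real.log n ∧
          ∀ x : Fin n → Bool,
            Real.exp (-(γ c * (K * (n / Real.sqrt (Real.log n))))) ≤ C.successProb R x := by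
  -- The block side is about `t = √(c log n / B)` with `B = 3 * (1 + 2 * d)`, which makes the depth
  -- bound `B * t ^ 2` equal `c log n` and the target exponent `(16 * d + 1) * A * n / t`. Here `16
  -- * d` is the `8 * d` of `exists_simulation` doubled by rounding `t` down, and `+ 1` serves the
  -- case `t < 1`.
  refine ⟨fun c => 1 / √c, fun d A => ⟨(16 * d + 1) * A * √(3 * (1 + 2 * d)), ?_⟩⟩
  rintro c hc n m hn R ⟨a, b, Q, inp, out, hab, hd, hR⟩
  have hlog : 0 < Real.log n := Real.log_pos (by exact_mod_cast hn)
  set B : ℝ := 3 * (1 + 2 * d) with hB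
  have hB0 : 0 < B := by positivity
  set t : ℝ := √(c * Real.log n / B) with ht
  have ht0 : 0 < t := Real.sqrt_pos.2 (by positivity)
  have htsq : B * t ^ 2 = c * Real.log n := by
    rw [ht, Real.sq_sqrt (by positivity)]
    field_simp
  have hexp : 1 / √c * ((16 * d + 1) * A * √B * (n / √(Real.log n))) =
      (16 * d + 1) * (A * n) / t := by
    rw [ht, Real.sqrt_div (by positivity), Real.sqrt_mul hc.le]
    field_simp
  have hab' : (a : ℝ) * b ≤ A * n := by exact_mod_cast hab
  simp only [hexp]
  -- With no room for a block of side 1, guess all `m ≤ A * n` output bits; as `t < 1`, this is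
  -- within `A * n / t` coins.
  by_cases ht1 : t < 1
  · refine ⟨ShallowGrid.randomOutput n m, ?_, fun x => ?_⟩
    · rw [ShallowGrid.randomOutput_depth]
      simpa using (mul_pos hc hlog).le
    · refine ShallowGrid.exp_neg_le_successProb _ R x ?_ ?_
      · obtain ⟨s, hs⟩ := Function.ne_iff.1
          (Q.apply_ne_zero (ShallowGrid.inputKet_ne_zero inp x))
        refine ⟨(fun j => s (out j) : Fin m → Bool), ?_⟩
        exact (congrArg (R x) (ShallowGrid.randomOutput_run n m x _)).trans
          ((hR _ _).2 ⟨s, fun _ => rfl, hs⟩)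
      · have hm : m ≤ a * b := by
          simpa using Fintype.card_le_of_embedding out
        have hm' : (m : ℝ) ≤ a * b := by exact_mod_cast hm
        rw [le_div_iff₀ ht0]
        have h₀ : (0 : ℝ) ≤ m := m.cast_nonneg
        have h₁ : (0 : ℝ) ≤ d * (A * n) := by positivity
        change (m : ℝ) * t ≤ _
        nlinarith
  · rw [not_lt] at ht1
    have hℓ : 0 < ⌊t⌋₊ := Nat.floor_pos.2 ht1
    have hℓt : (⌊t⌋₊ : ℝ) ≤ t := Nat.floor_le ht0.le
    have htℓ : t ≤ 2 * ⌊t⌋₊ := by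
      have h₁ := Nat.lt_floor_add_one t
      have h₂ : (1 : ℝ) ≤ ⌊t⌋₊ := by exact_mod_cast hℓ
      linarith
    obtain ⟨C, hC, hcoins, hrun⟩ := ShallowGrid.exists_simulation Q hd inp out hℓ
    refine ⟨C, ?_, fun x => ShallowGrid.exp_neg_le_successProb _ R x ?_ ?_⟩
    · calc (C.depth : ℝ) ≤ B * (⌊t⌋₊ : ℝ) ^ 2 := by rw [hB]; exact_mod_cast hC
        _ ≤ B * t ^ 2 := by gcongr
        _ = _ := htsq
    · obtain ⟨r, hr⟩ := hrun x
      exact ⟨r, (hR _ _).2 hr⟩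
    · rw [le_div_iff₀ ht0]
      have h₁ : (C.coins : ℝ) * ⌊t⌋₊ ≤ 8 * d * (a * b) := by exact_mod_cast hcoins
      have h₀ : (0 : ℝ) ≤ C.coins := C.coins.cast_nonneg
      have h₂ : (d : ℝ) * (a * b) ≤ d * (A * n) := by gcongr
      have h₃ : (0 : ℝ) ≤ A * n := by positivity
      nlinarith [mul_le_mul_of_nonneg_left htℓ h₀]
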